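/- For $n\ge 1$ let $\mathbb P_n$ be the probability measure on the symmetric group $S_n$ in which a permutation with $\mu_k$ cycles of length $k$ ($k=1,\dots,n$, fixed points being cycles of length $1$) has probability proportional to its weight $\prod_{k=1}^n\theta_k^{\mu_k}$, where $\theta_k=\zeta(2k)/2$ and $\zeta$ is the Riemann zeta function. Let $K_n(\sigma)$ be the number of cycles of $\sigma\in S_n$, let $\mathbb E_n$ be the expectation with respect to $\mathbb P_n$, and let $q_{n,\infty,1/2}(k)=\mathbb P_n(K_n=k)$. Let $$G(t)=\frac{t\,\Gamma(3/2)}{\Gamma(1+t/2)},$$ an entire function of $t$ (equal to $0$ at $t=-2,-4,-6,\dots$), and for $\lambda>0$ let $u_{\lambda,1/2}(k)$ be the Taylor coefficients at $t=0$ of $$e^{\lambda(t-1)}G(t)=\sum_{k\ge1}u_{\lambda,1/2}(k)\,t^k .$$ Then, as $n\to+\infty$: (1) uniformly for $t$ in any compact subset of $\mathbb C$, $$\mathbb E_n\big(t^{K_n}\big)=(2n)^{\frac{t-1}{2}}\Big(G(t)+O\big(\tfrac1n\big)\Big);$$ (2) uniformly for $t$ in any compact subset of $\mathbb C\setminus\{-2,-4,-6,\dots\}$,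 $$\mathbb E_n\big(t^{K_n}\big)=(2n)^{\frac{t-1}{2}}\,G(t)\,\Big(1+O\big(\tfrac1n\big)\Big);$$ (3) uniformly in $k\ge1$, with $\lambda_n=\tfrac12\log(2n)$, $$q_{n,\infty,1/2}(k)=u_{\lambda_n,1/2}(k)+O\big(\tfrac1n\big).$$ -/

import Mathlib

open Filter

noncomputable section

namespace CycleWeights

/-- The multiset of all cycle lengths of a permutation of `n` points; fixed points count as
cycles of length `1`. -/
def cycleLengths {n : ℕ} (σ : Equiv.Perm (Fin n)) : Multiset ℕ :=
  σ.partition.parts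

/-- The number of disjoint cycles of `σ`, fixed points included. -/
def numCycles {n : ℕ} (σ : Equiv.Perm (Fin n)) : ℕ :=
  Multiset.card (cycleLengths σ)

/-- The weight `θ₁ ^ μ₁ * θ₂ ^ μ₂ * ⋯ * θₙ ^ μₙ` of a permutation of cycle type
`(1 ^ μ₁, 2 ^ μ₂, …, n ^ μₙ)`. -/
def weight (θ : ℕ → ℝ) {n : ℕ} (σ : Equiv.Perm (Fin n)) : ℝ :=
  ∏ k ∈ Finset.Icc 1 n, θ k ^ Multiset.count k (cycleLengths σ)

/-- The normalized total weight `(1 / n!) * ∑ σ, w_θ(σ)`. -/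
def totalWeight (θ : ℕ → ℝ) (n : ℕ) : ℝ :=
  (1 / (n.factorial : ℝ)) * ∑ σ : Equiv.Perm (Fin n), weight θ σ

/-- The probability of a single permutation. -/
def prob (θ : ℕ → ℝ) {n : ℕ} (σ : Equiv.Perm (Fin n)) : ℝ :=
  weight θ σ / ((n.factorial : ℝ) * totalWeight θ n)

/-- The expectation of a complex random variable on the symmetric group. -/
def expectation (θ : ℕ → ℝ) {n : ℕ} (X : Equiv.Perm (Fin n) → ℂ) : ℂ :=
  ∑ σ : Equiv.Perm (Fin n), (prob θ σ : ℂ) * X σ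

/-- The probability that a random permutation of `n` points has exactly `k` cycles. -/
def cycleLaw (θ : ℕ → ℝ) (n k : ℕ) : ℝ :=
  ∑ σ : Equiv.Perm (Fin n) with numCycles σ = k, prob θ σ

/-- The weights `θ_k = ζ(2k) / 2`, `k ≥ 1` (these zeta values are real). -/
def zetaWeight (k : ℕ) : ℝ :=
  (riemannZeta (2 * (k : ℂ))).re / 2

/-- The entire function `t * Γ(3/2) / Γ(1 + t/2)`. At the poles `t = -2, -4, …` of `Γ(1 + t/2)`
its value is `0`, which is also what Mathlib's conventions for `Complex.Gamma` and division give. -/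
def limitFun (t : ℂ) : ℂ :=
  t * Complex.Gamma (3 / 2) / Complex.Gamma (1 + t / 2)

/-- The `k`-th Taylor coefficient at `t = 0` of `exp (lam * (t - 1)) * t * Γ(3/2) / Γ(1 + t/2)`. -/
def poissonGamma (lam : ℝ) (k : ℕ) : ℂ :=
  iteratedDeriv k (fun t : ℂ => Complex.exp ((lam : ℂ) * (t - 1)) * limitFun t) 0 /
    (k.factorial : ℂ)

end CycleWeights

end

namespace CycleWeights

/-! By the exponential formula, the normalized sum of `t ^ numCycles σ` times the weight is the
coefficient of z^n in exp(s ∑ ζ(2k) z^k / k) = ∏_{m ≥ 1} (1 - z/m²)^(-s) with s = t/2. The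
singularity nearest to 0 is z = 1, and it comes from the factor m = 1 alone. The remaining product
is analytic beyond z = 1 and equals 2^s there, because ∏_{m ≥ 2} (1 - 1/m²) = 1/2. Hence the
coefficient is n^(s-1) (2^s / Γ(s) + O(1/n)), uniformly for bounded s
(`exists_scaled_cycleSum_bound`). The proof is elementary: a sequence with geometric decay is
convolved with the coefficients of (1 - z)^(-s).

Dividing by the case s = 1/2 gives (2n)^((t-1)/2) (Γ(1/2)/Γ(t/2) + O(1/n)), and Γ(1/2)/Γ(t/2) is
`limitFun`. The additive error is `deviation`, an entire function of t, and
`exists_norm_deviation_le` is part (1). In part (2) the zero t = 0 of the limit is not excluded;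
since every permutation of n ≥ 1 points has a cycle, `deviation` vanishes there too, and the Schwarz
lemma supplies the missing factor t. Part (3) is Cauchy's estimate on the unit circle. -/

/-! ### The exponential formula over partitions -/

theorem prod_factorial_count_cons (k : ℕ) (m : Multiset ℕ) :
    ∏ j ∈ (k ::ₘ m).toFinset, ((k ::ₘ m).count j).factorial =
      (m.count k + 1) * ∏ j ∈ m.toFinset, (m.count j).factorial := by
  have h1 : ∏ j ∈ m.toFinset, (m.count j).factorial =
      ∏ j ∈ insert k m.toFinset, (m.count j).factorial := by
    refine Finset.prod_subset (Finset.subset_insert _ _) fun x _ hx => ?_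
    rw [Multiset.count_eq_zero_of_notMem (by simpa using hx), Nat.factorial_zero]
  rw [h1, Multiset.toFinset_cons, ← Finset.mul_prod_erase _ _ (Finset.mem_insert_self k _),
    ← Finset.mul_prod_erase (insert k m.toFinset) (fun j => (m.count j).factorial)
      (Finset.mem_insert_self k _), Multiset.count_cons_self, Nat.factorial_succ, ← mul_assoc]
  congr 1
  refine Finset.prod_congr rfl fun j hj => ?_
  rw [Multiset.count_cons_of_ne (Finset.ne_of_mem_erase hj)]

/-- The contribution `∏ c_k ^ μ_k / (μ_k! k ^ μ_k)` of the cycle type `m` to the exponential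
`exp (∑ c_k z ^ k / k)`. -/
noncomputable def typeWeight (c : ℕ → ℂ) (m : Multiset ℕ) : ℂ :=
  (m.map c).prod / ((m.prod * ∏ j ∈ m.toFinset, (m.count j).factorial : ℕ) : ℂ)

theorem typeWeight_cons (c : ℕ → ℂ) {k : ℕ} (hk : k ≠ 0) (m : Multiset ℕ) :
    ((k * (k ::ₘ m).count k : ℕ) : ℂ) * typeWeight c (k ::ₘ m) = c k * typeWeight c m := by
  have h1 : (k : ℂ) ≠ 0 := by exact_mod_cast hk
  have h2 : ((m.count k : ℂ) + 1) ≠ 0 := by exact_mod_cast Nat.succ_ne_zero (m.count k)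
  rw [typeWeight, typeWeight, prod_factorial_count_cons, Multiset.prod_cons, Multiset.map_cons,
    Multiset.prod_cons, Multiset.count_cons_self]
  push_cast
  field_simp

/-- The coefficient of `z ^ n` in `exp (∑ c_k z ^ k / k)`, as a sum over partitions. -/
noncomputable def cycleSum (c : ℕ → ℂ) (n : ℕ) : ℂ :=
  ∑ p : n.Partition, typeWeight c p.parts

theorem sum_eq_sum_mul_count {n : ℕ} (p : n.Partition) :
    n = ∑ k ∈ Finset.Icc 1 n, k * p.parts.count k := by
  conv_lhs => rw [← p.parts_sum]
  rw [Finset.sum_multiset_count]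
  simp only [smul_eq_mul, mul_comm]
  refine Finset.sum_subset (fun x hx => ?_) fun x _ hx => ?_
  · rw [Multiset.mem_toFinset] at hx
    exact Finset.mem_Icc.2 ⟨p.parts_pos hx, p.le_of_mem_parts hx⟩
  · rw [Multiset.count_eq_zero_of_notMem (by simpa using hx), mul_zero]

/-- Removing one part k is a bijection from the partitions of n containing k to the partitions of n
- k; the other partitions have multiplicity 0 and drop out. -/
theorem sum_mul_count_mul_typeWeight (c : ℕ → ℂ) {n k : ℕ} (h1 : 1 ≤ k) (hn : k ≤ n) :
    ∑ p : n.Partition, ((k * p.parts.count k : ℕ) : ℂ) * typeWeight c p.parts =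
      c k * cycleSum c (n - k) := by
  classical
  rw [cycleSum, Finset.mul_sum,
    ← Fintype.sum_subtype_add_sum_subtype (fun p : n.Partition => k ∈ p.parts)]
  rw [Finset.sum_eq_zero (s := (Finset.univ : Finset {p : n.Partition // ¬ k ∈ p.parts})), add_zero]
  · refine Fintype.sum_equiv (Nat.Partition.partitionWithPartEquiv h1 hn) _ _ fun p => ?_
    rw [Nat.Partition.partitionWithPartEquiv_apply_parts, ← typeWeight_cons c (by omega),
      Multiset.cons_erase p.2]
  · intro p _
    rw [Multiset.count_eq_zero_of_notMem p.2]
    simp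

/-- `e` is the coefficient sequence of `exp (∑ c_k z ^ k / k)`. -/
def IsExpSeq (c e : ℕ → ℂ) : Prop :=
  e 0 = 1 ∧ ∀ n : ℕ, ((n : ℂ) + 1) * e (n + 1) =
    ∑ p ∈ Finset.HasAntidiagonal.antidiagonal n, c (p.1 + 1) * e p.2

/-- Writing n + 1 as the sum of k times the multiplicity of k distributes (n + 1) · `cycleSum` over
the part that is removed. -/
theorem isExpSeq_cycleSum (c : ℕ → ℂ) : IsExpSeq c (cycleSum c) := by
  constructor
  · rw [cycleSum, Fintype.sum_unique, Nat.Partition.partition_zero_parts]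
    simp [typeWeight]
  · intro n
    rw [Finset.Nat.sum_antidiagonal_eq_sum_range_succ (fun i j => c (i + 1) * cycleSum c j)]
    have h : ∀ i ∈ Finset.range (n + 1), c (i + 1) * cycleSum c (n - i) =
        ∑ p : (n + 1).Partition,
          (((i + 1) * p.parts.count (i + 1) : ℕ) : ℂ) * typeWeight c p.parts := by
      intro i hi
      rw [Finset.mem_range] at hi
      rw [sum_mul_count_mul_typeWeight c (by omega) (by omega)]
      congr 2
      omega
    rw [Finset.sum_congr rfl h, Finset.sum_comm, cycleSum, Finset.mul_sum]
    refine Finset.sum_congr rfl fun p _ => ?_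
    rw [← Finset.sum_mul]
    congr 1
    have := sum_eq_sum_mul_count p
    rw [← Finset.Ico_add_one_right_eq_Icc, Finset.sum_Ico_eq_sum_range] at this
    rw [← Nat.cast_sum]
    norm_cast
    simpa [add_comm] using this

theorem IsExpSeq.eq {c e e' : ℕ → ℂ} (h : IsExpSeq c e) (h' : IsExpSeq c e') : e = e' := by
  funext n
  induction n using Nat.strong_induction_on with
  | _ n ih =>
    rcases n with _ | n
    · rw [h.1, h'.1]
    · have hn : ((n : ℂ) + 1) ≠ 0 := by exact_mod_cast Nat.succ_ne_zero n
      refine mul_left_cancel₀ hn ?_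
      rw [h.2, h'.2]
      refine Finset.sum_congr rfl fun p hp => ?_
      rw [ih p.2 (by have := Finset.HasAntidiagonal.mem_antidiagonal.1 hp; omega)]

/-- The recurrence is the equation E' = C · E read coefficientwise, which turns products of
exponentials into the Leibniz rule. -/
theorem isExpSeq_iff_powerSeries {c e : ℕ → ℂ} : IsExpSeq c e ↔
    e 0 = 1 ∧ PowerSeries.derivative ℂ (PowerSeries.mk e) =
      PowerSeries.mk (fun i => c (i + 1)) * PowerSeries.mk e := by
  refine and_congr_right fun _ => ?_
  rw [PowerSeries.ext_iff]
  refine forall_congr' fun n => ?_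
  rw [PowerSeries.coeff_derivative, PowerSeries.coeff_mul]
  simp only [PowerSeries.coeff_mk]
  rw [mul_comm]

theorem IsExpSeq.mul {c d e f : ℕ → ℂ} (h : IsExpSeq c e) (h' : IsExpSeq d f) :
    IsExpSeq (fun k => c k + d k)
      (fun n => ∑ p ∈ Finset.HasAntidiagonal.antidiagonal n, e p.1 * f p.2) := by
  rw [isExpSeq_iff_powerSeries] at *
  have h1 : PowerSeries.mk (fun n => ∑ p ∈ Finset.HasAntidiagonal.antidiagonal n, e p.1 * f p.2) =
      PowerSeries.mk e * PowerSeries.mk f := by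
    ext n
    simp [PowerSeries.coeff_mul]
  have h2 : PowerSeries.mk (fun i => c (i + 1) + d (i + 1)) =
      PowerSeries.mk (fun i => c (i + 1)) + PowerSeries.mk (fun i => d (i + 1)) := by
    ext n
    simp
  refine ⟨by simp [h.1, h'.1], ?_⟩
  rw [h1, h2, Derivation.leibniz, h.2, h'.2, smul_eq_mul, smul_eq_mul]
  ring

/-! ### From permutations to partitions -/

theorem card_perm_partition {n : ℕ} (p : n.Partition) :
    (Finset.univ.filter fun σ : Equiv.Perm (Fin n) => cycleLengths σ = p.parts).card *
      (p.parts.prod * ∏ j ∈ p.parts.toFinset, (p.parts.count j).factorial) = n.factorial := by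
  classical
  -- `cycleType` omits fixed points, so the partition is split into its parts ≥ 2 and r ones; the
  -- ones contribute r! to the count.
  set m := p.parts.filter (fun k => 2 ≤ k) with hm
  set r := p.parts.count 1 with hr
  have hp : p.parts = m + Multiset.replicate r 1 := by
    ext a
    rw [Multiset.count_add, Multiset.count_replicate, hm, Multiset.count_filter]
    rcases Nat.lt_or_ge a 2 with h | h
    · rw [if_neg (by omega)]
      rcases Nat.lt_or_ge a 1 with h' | h'
      · rw [if_neg (by omega), Multiset.count_eq_zero_of_notMem]
        intro ha
        have := p.parts_pos ha
        omega
      · rw [if_pos (by omega), show a = 1 by omega, zero_add]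
    · rw [if_pos h, if_neg (by omega), add_zero]
  have hsum : m.sum + r = n := by
    have := p.parts_sum
    rw [hp] at this
    simpa using this
  have h2 : ∀ a ∈ m, 2 ≤ a := fun a ha => (Multiset.mem_filter.1 ha).2
  have hset : (Finset.univ.filter fun σ : Equiv.Perm (Fin n) => cycleLengths σ = p.parts) =
      Finset.univ.filter fun σ : Equiv.Perm (Fin n) => σ.cycleType = m := by
    ext σ
    rw [Finset.mem_filter, Finset.mem_filter, cycleLengths]
    simp only [Finset.mem_univ, true_and]
    constructor
    · intro h
      rw [← Equiv.Perm.filter_parts_partition_eq_cycleType, h]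
    · intro h
      rw [Equiv.Perm.parts_partition, h, hp, ← Equiv.Perm.sum_cycleType, h, Fintype.card_fin,
        ← hsum, Nat.add_sub_cancel_left]
  have key := Equiv.Perm.card_of_cycleType_mul_eq (Fin n) m
  rw [if_pos ⟨by rw [Fintype.card_fin]; omega, h2⟩, Fintype.card_fin] at key
  rw [hset, ← key]
  congr 1
  have hprod : p.parts.prod = m.prod := by rw [hp]; simp
  have h1m : 1 ∉ m := fun h => by have := h2 1 h; omega
  have hcount : ∏ j ∈ p.parts.toFinset, (p.parts.count j).factorial =
      r.factorial * ∏ j ∈ m.toFinset, (m.count j).factorial := by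
    have e1 : ∏ j ∈ p.parts.toFinset, (p.parts.count j).factorial =
        ∏ j ∈ insert 1 m.toFinset, (p.parts.count j).factorial := by
      refine Finset.prod_subset (fun x hx => ?_) fun x _ hx => ?_
      · rw [Multiset.mem_toFinset, hp, Multiset.mem_add] at hx
        rcases hx with hx | hx
        · exact Finset.mem_insert_of_mem (by simpa using hx)
        · rw [Multiset.eq_of_mem_replicate hx]; exact Finset.mem_insert_self _ _
      · rw [Multiset.count_eq_zero_of_notMem (by simpa using hx), Nat.factorial_zero]
    rw [e1, Finset.prod_insert (by simpa using h1m)]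
    congr 1
    refine Finset.prod_congr rfl fun j hj => ?_
    rw [hm, Multiset.count_filter_of_pos (h2 j (by simpa using hj))]
  rw [hprod, hcount, show n - m.sum = r by omega]
  ring

theorem weight_eq_prod_map (θ : ℕ → ℝ) {n : ℕ} (σ : Equiv.Perm (Fin n)) (t : ℂ) :
    (weight θ σ : ℂ) * t ^ numCycles σ =
      ((cycleLengths σ).map fun k => t * (θ k : ℂ)).prod := by
  have hpow : t ^ numCycles σ = ((cycleLengths σ).map fun _ => t).prod := by
    simp [numCycles]
  rw [Multiset.prod_map_mul, ← hpow, mul_comm, weight]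
  congr 1
  rw [Finset.prod_multiset_map_count]
  push_cast
  symm
  refine Finset.prod_subset (fun x hx => ?_) fun x _ hx => ?_
  · rw [Multiset.mem_toFinset] at hx
    have h2 := σ.partition.le_of_mem_parts hx
    rw [Fintype.card_fin] at h2
    exact Finset.mem_Icc.2 ⟨σ.partition.parts_pos hx, h2⟩
  · rw [Multiset.count_eq_zero_of_notMem (by simpa using hx), pow_zero]

theorem sum_prod_map_cycleLengths (c : ℕ → ℂ) (n : ℕ) :
    ∑ σ : Equiv.Perm (Fin n), ((cycleLengths σ).map c).prod = n.factorial * cycleSum c n := by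
  classical
  have hsplit : ∀ σ : Equiv.Perm (Fin n), ((cycleLengths σ).map c).prod =
      ∑ p : n.Partition, if cycleLengths σ = p.parts then (p.parts.map c).prod else 0 := by
    intro σ
    have hsum : (cycleLengths σ).sum = n := by
      exact σ.partition.parts_sum.trans (Fintype.card_fin n)
    let q : n.Partition := ⟨cycleLengths σ, fun h => σ.partition.parts_pos h, hsum⟩
    rw [Finset.sum_eq_single q]
    · simp [q]
    · intro p _ hp
      refine if_neg fun h => hp ?_
      ext1
      exact h.symm
    · simp
  simp_rw [hsplit]
  rw [Finset.sum_comm, cycleSum, Finset.mul_sum]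
  refine Finset.sum_congr rfl fun p _ => ?_
  rw [← Finset.sum_filter, Finset.sum_const, nsmul_eq_mul, ← card_perm_partition p, typeWeight]
  have hne : ((p.parts.prod * ∏ j ∈ p.parts.toFinset, (p.parts.count j).factorial : ℕ) : ℂ) ≠ 0 := by
    have h := card_perm_partition p
    intro h0
    rw [Nat.cast_eq_zero.1 h0, mul_zero] at h
    exact (Nat.factorial_pos n).ne h
  rw [Nat.cast_mul, mul_assoc, mul_div_cancel₀ _ hne]

theorem totalWeight_eq_cycleSum (θ : ℕ → ℝ) (n : ℕ) :
    (totalWeight θ n : ℂ) = cycleSum (fun k => (θ k : ℂ)) n := by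
  have h := sum_prod_map_cycleLengths (fun k => (θ k : ℂ)) n
  have hf : (n.factorial : ℂ) ≠ 0 := by exact_mod_cast n.factorial_ne_zero
  have h2 : ∀ σ : Equiv.Perm (Fin n), ((cycleLengths σ).map fun k => (θ k : ℂ)).prod =
      (weight θ σ : ℂ) := by
    intro σ
    simpa using (weight_eq_prod_map θ σ 1).symm
  simp_rw [h2] at h
  rw [totalWeight]
  push_cast
  rw [h, ← mul_assoc, one_div_mul_cancel hf, one_mul]

theorem expectation_pow_numCycles (θ : ℕ → ℝ) (n : ℕ) (t : ℂ) :
    expectation θ (fun σ : Equiv.Perm (Fin n) => t ^ numCycles σ) =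
      cycleSum (fun k => t * (θ k : ℂ)) n / cycleSum (fun k => (θ k : ℂ)) n := by
  have hf : (n.factorial : ℂ) ≠ 0 := by exact_mod_cast n.factorial_ne_zero
  rw [← totalWeight_eq_cycleSum, expectation, ← mul_div_mul_left _ _ hf,
    ← sum_prod_map_cycleLengths, Finset.sum_div]
  refine Finset.sum_congr rfl fun σ _ => ?_
  rw [← weight_eq_prod_map, prob]
  push_cast
  ring

/-! ### Coefficients of (1 - z)^(-s) and the reciprocal Gamma function -/

/-- The coefficient of `z ^ m` in `(1 - z) ^ (-s)`. -/
noncomputable def risingCoeff (s : ℂ) (m : ℕ) : ℂ :=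
  (∏ j ∈ Finset.range m, (s + j)) / (m.factorial : ℂ)

@[simp]
theorem risingCoeff_zero (s : ℂ) : risingCoeff s 0 = 1 := by
  simp [risingCoeff]

theorem risingCoeff_succ (s : ℂ) (m : ℕ) :
    ((m : ℂ) + 1) * risingCoeff s (m + 1) = (s + m) * risingCoeff s m := by
  have h1 : ((m : ℂ) + 1) ≠ 0 := by exact_mod_cast Nat.succ_ne_zero m
  have h2 : (m.factorial : ℂ) ≠ 0 := by exact_mod_cast m.factorial_ne_zero
  rw [risingCoeff, risingCoeff, Finset.prod_range_succ, Nat.factorial_succ]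
  push_cast
  field_simp

theorem risingCoeff_sub_one_succ (s : ℂ) (m : ℕ) :
    ((m : ℂ) + 1) * risingCoeff (s - 1) (m + 1) = (s - 1) * risingCoeff s m := by
  have h1 : ((m : ℂ) + 1) ≠ 0 := by exact_mod_cast Nat.succ_ne_zero m
  have h2 : (m.factorial : ℂ) ≠ 0 := by exact_mod_cast m.factorial_ne_zero
  rw [risingCoeff, risingCoeff, Finset.prod_range_succ', Nat.factorial_succ]
  have h3 : ∀ k ∈ Finset.range m, s - 1 + ((k + 1 : ℕ) : ℂ) = s + k := by
    intro k _
    push_cast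
    ring
  rw [Finset.prod_congr rfl h3]
  push_cast
  field_simp
  ring

/-- Multiplying (1 - z)^(-s) by 1 - z gives (1 - z)^(-(s-1)): consecutive differences gain a factor
of order 1/m. -/
theorem risingCoeff_succ_sub (s : ℂ) (m : ℕ) :
    risingCoeff s (m + 1) - risingCoeff s m = risingCoeff (s - 1) (m + 1) := by
  have h1 : ((m : ℂ) + 1) ≠ 0 := by exact_mod_cast Nat.succ_ne_zero m
  refine mul_left_cancel₀ h1 ?_
  rw [mul_sub, risingCoeff_succ, risingCoeff_sub_one_succ]
  ring

theorem isExpSeq_risingCoeff (s : ℂ) : IsExpSeq (fun _ => s) (risingCoeff s) := by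
  refine ⟨risingCoeff_zero s, fun n => ?_⟩
  rw [Finset.Nat.sum_antidiagonal_eq_sum_range_succ (fun _ j => s * risingCoeff s j),
    ← Finset.sum_range_reflect]
  have h : ∀ n : ℕ, (n : ℂ) * risingCoeff s n = ∑ j ∈ Finset.range n, s * risingCoeff s j := by
    intro n
    induction n with
    | zero => simp
    | succ n ih =>
      rw [Finset.sum_range_succ, ← ih]
      push_cast
      rw [risingCoeff_succ]
      ring
  have := h (n + 1)
  push_cast at this
  rw [this]
  refine Finset.sum_congr rfl fun j hj => ?_
  rw [Finset.mem_range] at hj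
  congr 2
  omega

/-- The coefficient `risingCoeff s m`, rescaled so as to converge to `1 / Γ(s)`. -/
noncomputable def scaledCoeff (s : ℂ) (m : ℕ) : ℂ :=
  (m : ℂ) ^ (1 - s) * risingCoeff s m

theorem scaledCoeff_one (s : ℂ) : scaledCoeff s 1 = s := by
  simp [scaledCoeff, risingCoeff]

theorem scaledCoeff_succ (s : ℂ) {m : ℕ} (hm : 1 ≤ m) :
    scaledCoeff s (m + 1) =
      Complex.exp (-s * (Real.log (1 + 1 / m) : ℝ)) * (1 + s / m) * scaledCoeff s m := by
  have h0 : (0 : ℝ) < m := by exact_mod_cast hm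
  have hm0 : (m : ℂ) ≠ 0 := by exact_mod_cast h0.ne'
  have h1 : ((m : ℂ) + 1) ≠ 0 := by exact_mod_cast Nat.succ_ne_zero m
  have hlog : Real.log (1 + 1 / m) = Real.log ((m + 1 : ℕ) : ℝ) - Real.log m := by
    rw [← Real.log_div (by positivity) h0.ne']
    congr 1
    push_cast
    field_simp
  have hpow : ∀ k : ℕ, k ≠ 0 → (k : ℂ) ^ (1 - s) = k * Complex.exp (-s * (Real.log k : ℝ)) := by
    intro k hk
    have hk0 : (k : ℂ) ≠ 0 := by exact_mod_cast hk
    rw [sub_eq_add_neg, Complex.cpow_add _ _ hk0, Complex.cpow_one, Complex.cpow_def_of_ne_zero hk0,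
      Complex.natCast_log, mul_comm (-s)]
  rw [scaledCoeff, scaledCoeff, hpow _ (by omega), hpow m (by omega), hlog]
  have h2 : Complex.exp (-s * ((Real.log ((m + 1 : ℕ) : ℝ) - Real.log m : ℝ) : ℂ)) *
      Complex.exp (-s * (Real.log m : ℝ)) =
      Complex.exp (-s * (Real.log ((m + 1 : ℕ) : ℝ) : ℝ)) := by
    rw [← Complex.exp_add]
    congr 1
    push_cast
    ring
  rw [← h2]
  have h3 := risingCoeff_succ s m
  rw [show ((m + 1 : ℕ) : ℂ) = (m : ℂ) + 1 by push_cast; ring]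
  linear_combination (Complex.exp (-s * ((Real.log ((m + 1 : ℕ) : ℝ) - Real.log m : ℝ) : ℂ)) *
      Complex.exp (-s * (Real.log m : ℝ))) * h3 +
      (Complex.exp (-s * ((Real.log ((m + 1 : ℕ) : ℝ) - Real.log m : ℝ) : ℂ)) *
      Complex.exp (-s * (Real.log m : ℝ))) * risingCoeff s m * (-s) * (mul_inv_cancel₀ hm0)

/-- The terms of first order in 1/m cancel, leaving O(1/m²). The bound is put in telescoping form so
that its sums and products are explicit. -/
theorem norm_exp_neg_mul_log_mul_sub_one_le {A : ℝ} (hA : 0 ≤ A) {s : ℂ} (hs : ‖s‖ ≤ A) {m : ℕ}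
    (hm : 1 ≤ m) :
    ‖Complex.exp (-s * (Real.log (1 + 1 / m) : ℝ)) * (1 + s / m) - 1‖ ≤
      2 * (A + A ^ 2 + A ^ 2 * Real.exp A * (1 + A)) * (1 / m - 1 / (m + 1)) := by
  have hm1 : (1 : ℝ) ≤ m := by exact_mod_cast hm
  set x : ℝ := 1 / m with hx
  have hx0 : 0 < x := by positivity
  have hx1 : x ≤ 1 := by rw [hx, div_le_one (by linarith)]; exact hm1
  set l : ℝ := Real.log (1 + x) with hl
  have hl0 : 0 ≤ l := Real.log_nonneg (by linarith)
  have hlx : l ≤ x := by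
    have := Real.log_le_sub_one_of_pos (show 0 < 1 + x by linarith)
    linarith
  have hlx2 : x - l ≤ x ^ 2 := by
    have := Real.one_sub_inv_le_log_of_pos (show 0 < 1 + x by linarith)
    have h2 : x - x ^ 2 ≤ 1 - (1 + x)⁻¹ := by
      have h3 : 1 - (1 + x)⁻¹ = x / (1 + x) := by field_simp; ring
      rw [h3, le_div_iff₀ (by linarith)]
      nlinarith [pow_pos hx0 3]
    linarith
  set r : ℂ := Complex.exp (-s * l) - (1 - s * l) with hr
  have hsl : ‖-s * (l : ℂ)‖ ≤ A * x := by
    rw [norm_mul, norm_neg, Complex.norm_real, Real.norm_of_nonneg hl0]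
    exact mul_le_mul hs hlx hl0 hA
  have hrn : ‖r‖ ≤ A ^ 2 * Real.exp A * x ^ 2 := by
    have h := Complex.norm_exp_sub_sum_le_norm_mul_exp (-s * (l : ℂ)) 2
    have h2 : Complex.exp (-s * l) - ∑ i ∈ Finset.range 2, (-s * (l : ℂ)) ^ i / (i.factorial : ℂ) =
        r := by
      rw [hr]
      simp [Finset.sum_range_succ]
      ring
    rw [h2] at h
    calc ‖r‖ ≤ ‖-s * (l : ℂ)‖ ^ 2 * Real.exp ‖-s * (l : ℂ)‖ := h
      _ ≤ (A * x) ^ 2 * Real.exp A := by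
        gcongr
        exact hsl.trans (mul_le_of_le_one_right hA hx1)
      _ = _ := by ring
  have hxc : s / (m : ℂ) = s * (x : ℂ) := by
    rw [hx]; push_cast; rw [mul_one_div]
  have hdec : Complex.exp (-s * l) * (1 + s / m) - 1 =
      s * ((x - l : ℝ) : ℂ) - s ^ 2 * ((l * x : ℝ) : ℂ) + r * (1 + s * (x : ℂ)) := by
    rw [hxc, hr]
    push_cast
    ring
  have hx2 : x ^ 2 ≤ 2 * (1 / m - 1 / (m + 1)) := by
    rw [hx]
    have : (1 : ℝ) / m - 1 / (m + 1) = 1 / (m * (m + 1)) := by field_simp; ring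
    rw [this, div_pow, one_pow, mul_one_div, div_le_div_iff₀ (by positivity) (by positivity)]
    nlinarith
  rw [hdec]
  calc _ ≤ ‖s * ((x - l : ℝ) : ℂ)‖ + ‖s ^ 2 * ((l * x : ℝ) : ℂ)‖ + ‖r * (1 + s * (x : ℂ))‖ :=
        (norm_add_le _ _).trans (add_le_add_left (norm_sub_le _ _) _)
    _ ≤ A * x ^ 2 + A ^ 2 * x ^ 2 + (A ^ 2 * Real.exp A * x ^ 2) * (1 + A) := by
      rw [norm_mul, norm_mul, norm_mul, norm_pow, Complex.norm_real, Complex.norm_real,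
        Real.norm_of_nonneg (by linarith), Real.norm_of_nonneg (by positivity)]
      have h1 : ‖1 + s * (x : ℂ)‖ ≤ 1 + A := by
        refine (norm_add_le _ _).trans ?_
        rw [norm_one, norm_mul, Complex.norm_real, Real.norm_of_nonneg hx0.le]
        gcongr
        exact (mul_le_of_le_one_right (norm_nonneg _) hx1).trans hs
      have h2 : l * x ≤ x ^ 2 := by nlinarith
      gcongr
    _ = (A + A ^ 2 + A ^ 2 * Real.exp A * (1 + A)) * x ^ 2 := by ring
    _ ≤ (A + A ^ 2 + A ^ 2 * Real.exp A * (1 + A)) * (2 * (1 / m - 1 / (m + 1))) := by gcongr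
    _ = _ := by ring

theorem tendsto_scaledCoeff (s : ℂ) :
    Tendsto (scaledCoeff s) atTop (nhds (Complex.Gamma s)⁻¹) := by
  by_cases hs : ∃ m : ℕ, s = -m
  · obtain ⟨m, rfl⟩ := hs
    rw [Complex.Gamma_neg_nat_eq_zero, inv_zero]
    refine tendsto_const_nhds.congr' ?_
    filter_upwards [eventually_gt_atTop m] with n hn
    rw [scaledCoeff, risingCoeff, Finset.prod_eq_zero (Finset.mem_range.2 hn) (by simp)]
    simp
  · push Not at hs
    have h1 := (Complex.GammaSeq_tendsto_Gamma s).inv₀ (Complex.Gamma_ne_zero hs)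
    -- `GammaSeq` carries one more factor, s + n, than `risingCoeff s n`; n / (n + s) → 1 corrects
    -- for it.
    have h2 := h1.mul (tendsto_natCast_div_add_atTop s)
    rw [mul_one] at h2
    refine h2.congr' ?_
    filter_upwards [eventually_ge_atTop 1] with n hn
    have hn0 : (n : ℂ) ≠ 0 := by exact_mod_cast (show n ≠ 0 by omega)
    have hsn : s + n ≠ 0 := fun h => hs n (eq_neg_of_add_eq_zero_left h)
    have hp : (n : ℂ) ^ s ≠ 0 := by rw [Complex.cpow_ne_zero_iff]; exact Or.inl hn0
    rw [scaledCoeff, risingCoeff, Complex.GammaSeq, Finset.prod_range_succ, Complex.cpow_sub _ _ hn0,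
      Complex.cpow_one, inv_div, add_comm (n : ℂ) s]
    field_simp

/-- A discrete Grönwall argument bounds the sequence by B; the increments are then dominated by a
telescoping series, and letting the larger index tend to infinity gives the rate 1/m. -/
theorem exists_scaledCoeff_bound (A : ℝ) :
    ∃ C : ℝ, 0 ≤ C ∧ ∀ s : ℂ, ‖s‖ ≤ A → ‖(Complex.Gamma s)⁻¹‖ ≤ C ∧ ∀ m : ℕ, 1 ≤ m →
      ‖scaledCoeff s m‖ ≤ C ∧ ‖scaledCoeff s m - (Complex.Gamma s)⁻¹‖ ≤ C / m := by
  rcases lt_or_ge A 0 with hA | hA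
  · exact ⟨0, le_rfl, fun s hs => absurd (norm_nonneg s) (by linarith)⟩
  set D : ℝ := 2 * (A + A ^ 2 + A ^ 2 * Real.exp A * (1 + A)) with hD
  have hD0 : 0 ≤ D := by positivity
  set B : ℝ := A * Real.exp D with hB
  have hB0 : 0 ≤ B := by positivity
  refine ⟨B + D * B, by positivity, fun s hs => ?_⟩
  have hstep : ∀ m : ℕ, 1 ≤ m → ‖scaledCoeff s (m + 1) - scaledCoeff s m‖ ≤
      D * (1 / m - 1 / (m + 1)) * ‖scaledCoeff s m‖ := by
    intro m hm
    rw [scaledCoeff_succ s hm, ← sub_one_mul, norm_mul]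
    gcongr
    exact norm_exp_neg_mul_log_mul_sub_one_le hA hs hm
  have hb' : ∀ m : ℕ, 1 ≤ m → ‖scaledCoeff s m‖ ≤ A * Real.exp (D * (1 - 1 / m)) := by
    intro m hm
    induction m, hm using Nat.le_induction with
    | base => simpa [scaledCoeff_one] using hs
    | succ m hm ih =>
      calc ‖scaledCoeff s (m + 1)‖
          ≤ ‖scaledCoeff s (m + 1) - scaledCoeff s m‖ + ‖scaledCoeff s m‖ := by
            simpa using norm_add_le (scaledCoeff s (m + 1) - scaledCoeff s m) (scaledCoeff s m)
        _ ≤ (D * (1 / m - 1 / (m + 1)) + 1) * ‖scaledCoeff s m‖ := by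
            linarith [hstep m hm]
        _ ≤ Real.exp (D * (1 / m - 1 / (m + 1))) * (A * Real.exp (D * (1 - 1 / m))) :=
            mul_le_mul (Real.add_one_le_exp _) ih (norm_nonneg _) (Real.exp_pos _).le
        _ = _ := by
            rw [mul_left_comm, ← Real.exp_add]
            push_cast
            congr 2
            ring
  have hb : ∀ m : ℕ, 1 ≤ m → ‖scaledCoeff s m‖ ≤ B := by
    intro m hm
    refine (hb' m hm).trans ?_
    rw [hB]
    gcongr
    have : (0 : ℝ) ≤ 1 / m := by positivity
    nlinarith
  have hdist : ∀ m : ℕ, 1 ≤ m → ∀ p : ℕ, m ≤ p →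
      ‖scaledCoeff s p - scaledCoeff s m‖ ≤ D * B * (1 / m - 1 / p) := by
    intro m hm p hp
    induction p, hp using Nat.le_induction with
    | base => simp
    | succ p hp ih =>
      have hp1 : 1 ≤ p := hm.trans hp
      have hp0 : (0 : ℝ) ≤ 1 / p - 1 / (p + 1) := by
        have : (0 : ℝ) < p := by exact_mod_cast hp1
        rw [sub_nonneg]
        gcongr
        linarith
      have h1 := norm_add_le (scaledCoeff s (p + 1) - scaledCoeff s p)
        (scaledCoeff s p - scaledCoeff s m)
      rw [sub_add_sub_cancel] at h1
      have h2 := hstep p hp1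
      have h3 := mul_le_mul_of_nonneg_left (hb p hp1) (mul_nonneg hD0 hp0)
      push_cast
      nlinarith
  have hlim := tendsto_scaledCoeff s
  have hGamma : ‖(Complex.Gamma s)⁻¹‖ ≤ B := by
    refine le_of_tendsto hlim.norm ?_
    filter_upwards [eventually_ge_atTop 1] with m hm using hb m hm
  refine ⟨hGamma.trans (by nlinarith [mul_nonneg hD0 hB0]), fun m hm =>
    ⟨(hb m hm).trans (by nlinarith [mul_nonneg hD0 hB0]), ?_⟩⟩
  rw [norm_sub_rev]
  refine le_of_tendsto (hlim.sub_const _).norm ?_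
  filter_upwards [eventually_ge_atTop m] with p hp
  refine (hdist m hm p hp).trans ?_
  have hm0 : (0 : ℝ) < m := by exact_mod_cast hm
  rw [mul_sub, mul_one_div]
  have : 0 ≤ D * B * (1 / p) := by positivity
  have h5 : D * B / m ≤ (B + D * B) / m := by gcongr; linarith
  linarith

theorem exists_risingCoeff_bound (A : ℝ) :
    ∃ C : ℝ, 0 ≤ C ∧ ∀ s : ℂ, ‖s‖ ≤ A → ∀ m : ℕ, 1 ≤ m →
      ‖risingCoeff s m‖ ≤ C * (m : ℝ) ^ (s.re - 1) := by
  obtain ⟨C, hC, h⟩ := exists_scaledCoeff_bound A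
  refine ⟨C, hC, fun s hs m hm => ?_⟩
  have hm0 : (0 : ℝ) < m := by exact_mod_cast hm
  have h1 := ((h s hs).2 m hm).1
  rw [scaledCoeff, norm_mul, Complex.norm_natCast_cpow_of_pos (by omega)] at h1
  have h2 : (m : ℝ) ^ (s.re - 1) * (m : ℝ) ^ (1 - s).re = 1 := by
    rw [← Real.rpow_add hm0]
    simp
  have hpos : 0 < (m : ℝ) ^ (s.re - 1) := by positivity
  calc ‖risingCoeff s m‖ = (m : ℝ) ^ (s.re - 1) * ((m : ℝ) ^ (1 - s).re * ‖risingCoeff s m‖) := by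
        rw [← mul_assoc, h2, one_mul]
    _ ≤ (m : ℝ) ^ (s.re - 1) * C := by gcongr
    _ = _ := mul_comm _ _

/-! ### Exponentials of geometrically decaying series -/

/-- Passing from 1/4 to 1/2 leaves a geometric sum at most 1, so each step of the recurrence costs
N/(n + 1). This exceeds 1 only while n + 1 < N, hence the exponent `min n N` in the induction. -/
theorem IsExpSeq.norm_le {c e : ℕ → ℂ} (h : IsExpSeq c e) {N : ℕ}
    (hc : ∀ k : ℕ, ‖c (k + 1)‖ ≤ N * (1 / 4) ^ (k + 1)) (n : ℕ) :
    ‖e n‖ ≤ (N + 1 : ℝ) ^ N * (1 / 2) ^ n := by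
  have hmono : ∀ a b : ℕ, a ≤ b → ((N : ℝ) + 1) ^ a ≤ ((N : ℝ) + 1) ^ b := fun a b hab =>
    pow_le_pow_right₀ (by linarith [Nat.cast_nonneg (α := ℝ) N]) hab
  have key : ∀ n : ℕ, ‖e n‖ ≤ ((N : ℝ) + 1) ^ min n N * (1 / 2) ^ n := by
    intro n
    induction n using Nat.strong_induction_on with
    | _ n ih =>
      rcases n with _ | n
      · simp [h.1]
      · have h1 : ((n : ℝ) + 1) * ‖e (n + 1)‖ ≤
            N * ((N : ℝ) + 1) ^ min n N * (1 / 2) ^ (n + 1) := by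
          have h2 : ((n : ℝ) + 1) * ‖e (n + 1)‖ = ‖((n : ℂ) + 1) * e (n + 1)‖ := by
            rw [norm_mul]
            congr 1
            exact_mod_cast (Complex.norm_natCast (n + 1)).symm
          rw [h2, h.2]
          calc _ ≤ ∑ p ∈ Finset.HasAntidiagonal.antidiagonal n,
                N * ((N : ℝ) + 1) ^ min n N * (1 / 2) ^ (n + 1) * ((1 / 2) ^ (p.1 + 1)) := by
                refine norm_sum_le_of_le _ fun p hp => ?_
                have hp' := Finset.HasAntidiagonal.mem_antidiagonal.1 hp
                rw [norm_mul]
                calc _ ≤ N * (1 / 4 : ℝ) ^ (p.1 + 1) *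
                      (((N : ℝ) + 1) ^ min n N * (1 / 2) ^ p.2) := by
                      gcongr
                      · exact hc _
                      · refine (ih p.2 (by omega)).trans ?_
                        exact mul_le_mul_of_nonneg_right (hmono _ _ (by omega)) (by positivity)
                  _ = _ := by
                      rw [← hp', show (1 / 4 : ℝ) = 1 / 2 * (1 / 2) by norm_num, mul_pow]
                      ring
            _ ≤ _ := by
                rw [← Finset.mul_sum]
                refine mul_le_of_le_one_right (by positivity) ?_
                rw [Finset.Nat.sum_antidiagonal_eq_sum_range_succ
                  (fun i _ => (1 / 2 : ℝ) ^ (i + 1))]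
                have hg : ∀ m : ℕ, ∑ i ∈ Finset.range m, (1 / 2 : ℝ) ^ (i + 1) =
                    1 - (1 / 2) ^ m := by
                  intro m
                  induction m with
                  | zero => simp
                  | succ m ihm => rw [Finset.sum_range_succ, ihm]; ring
                rw [hg]
                have : (0 : ℝ) < (1 / 2) ^ (n + 1) := by positivity
                rw [Nat.succ_eq_add_one]
                linarith
        have hn : (0 : ℝ) < (n : ℝ) + 1 := by positivity
        refine le_of_mul_le_mul_left (h1.trans ?_) hn
        rw [← mul_assoc]
        refine mul_le_mul_of_nonneg_right ?_ (by positivity)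
        rcases Nat.lt_or_ge n N with hnN | hnN
        · rw [min_eq_left hnN.le, min_eq_left hnN, pow_succ]
          have h3 : (0 : ℝ) < ((N : ℝ) + 1) ^ n := by positivity
          nlinarith [mul_nonneg (Nat.cast_nonneg (α := ℝ) n)
            (mul_nonneg h3.le (by positivity : (0 : ℝ) ≤ N + 1))]
        · rw [min_eq_right hnN, min_eq_right (by omega)]
          have h3 : (N : ℝ) ≤ n := by exact_mod_cast hnN
          exact mul_le_mul_of_nonneg_right (by linarith) (by positivity)
  exact (key n).trans (mul_le_mul_of_nonneg_right (hmono _ _ (by omega)) (by positivity))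

theorem summable_norm_mul_pow {u : ℕ → ℂ} {M : ℝ} (hu : ∀ n, ‖u n‖ ≤ M * (1 / 2) ^ n) {z : ℂ}
    (hz : ‖z‖ < 3 / 2) : Summable fun n => ‖u n * z ^ n‖ := by
  refine Summable.of_nonneg_of_le (fun _ => norm_nonneg _) (fun n => ?_)
    ((summable_geometric_of_lt_one (r := (3 / 4 : ℝ)) (by norm_num) (by norm_num)).mul_left M)
  rw [norm_mul, norm_pow]
  calc _ ≤ M * (1 / 2) ^ n * (3 / 2) ^ n := by
        have := (norm_nonneg _).trans (hu n)
        gcongr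
        exact hu n
    _ = _ := by rw [mul_assoc, ← mul_pow]; norm_num

theorem hasDerivAt_tsum_mul_pow {u : ℕ → ℂ} {M : ℝ} (hu : ∀ n, ‖u n‖ ≤ M * (1 / 2) ^ n) {z : ℂ}
    (hz : ‖z‖ < 3 / 2) :
    HasDerivAt (fun z : ℂ => ∑' n, u n * z ^ n) (∑' n : ℕ, ((n : ℂ) + 1) * u (n + 1) * z ^ n) z := by
  have hM : 0 ≤ M := by simpa using (norm_nonneg _).trans (hu 0)
  have hsum : Summable fun n : ℕ => M * ((n : ℝ) ^ 1 * (3 / 4 : ℝ) ^ n) :=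
    (summable_pow_mul_geometric_of_norm_lt_one 1 (by norm_num)).mul_left M
  have hmem : ∀ {y : ℂ}, y ∈ Metric.ball (0 : ℂ) (3 / 2) → ‖y‖ < 3 / 2 := by simp
  have hbound : ∀ (n : ℕ) (y : ℂ), y ∈ Metric.ball (0 : ℂ) (3 / 2) →
      ‖u n * ((n : ℂ) * y ^ (n - 1))‖ ≤ M * ((n : ℝ) ^ 1 * (3 / 4 : ℝ) ^ n) := by
    intro n y hy
    rw [norm_mul, norm_mul, norm_pow, Complex.norm_natCast]
    calc _ ≤ M * (1 / 2) ^ n * (n * (3 / 2) ^ n) := by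
          gcongr
          · exact hu n
          · calc ‖y‖ ^ (n - 1) ≤ (3 / 2) ^ (n - 1) := by gcongr; exact (hmem hy).le
              _ ≤ _ := pow_le_pow_right₀ (by norm_num) (Nat.sub_le _ _)
      _ = _ := by
          rw [show (3 / 4 : ℝ) = 1 / 2 * (3 / 2) by norm_num, mul_pow]
          ring
  have hzb : z ∈ Metric.ball (0 : ℂ) (3 / 2) := by simpa using hz
  have h := hasDerivAt_tsum_of_isPreconnected (g := fun n z => u n * z ^ n)
    (g' := fun n y => u n * ((n : ℂ) * y ^ (n - 1))) hsum Metric.isOpen_ball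
    (convex_ball _ _).isPreconnected (fun n y _ => (hasDerivAt_pow n y).const_mul _) hbound hzb
    (summable_norm_mul_pow hu hz).of_norm hzb
  refine h.congr_deriv ?_
  have hs' : Summable fun n : ℕ => u n * ((n : ℂ) * z ^ (n - 1)) :=
    Summable.of_norm_bounded hsum fun n => hbound n z hzb
  rw [hs'.tsum_eq_zero_add]
  simp only [Nat.cast_zero, zero_mul, mul_zero, zero_add, Nat.add_sub_cancel]
  refine tsum_congr fun n => ?_
  push_cast
  ring

/-- On the disc of radius 3/2, which contains z = 1, the generating function φ satisfies φ' = γ' φ,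
where γ is the series in the exponent; so φ exp(-γ) is constant, equal to its value 1 at 0. -/
theorem IsExpSeq.hasSum {c e : ℕ → ℂ} (h : IsExpSeq c e) {M N : ℝ}
    (he : ∀ n, ‖e n‖ ≤ M * (1 / 2) ^ n) (hc : ∀ k : ℕ, ‖c (k + 1)‖ ≤ N * (1 / 2) ^ (k + 1)) :
    HasSum e (Complex.exp (∑' k : ℕ, c (k + 1) / (k + 1))) := by
  set g : ℕ → ℂ := fun n => c n / n with hg
  have hN : 0 ≤ N := by
    have := (norm_nonneg _).trans (hc 0)
    norm_num at this
    linarith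
  have hgb : ∀ n, ‖g n‖ ≤ N * (1 / 2) ^ n := by
    intro n
    rcases n with _ | n
    · simpa [hg] using hN
    · rw [hg, norm_div, Complex.norm_natCast]
      refine (div_le_self (norm_nonneg _) ?_).trans (hc n)
      push_cast
      linarith [Nat.cast_nonneg (α := ℝ) n]
  set φ : ℂ → ℂ := fun z => ∑' n, e n * z ^ n
  set γ : ℂ → ℂ := fun z => ∑' n, g n * z ^ n
  set cs : ℂ → ℂ := fun z => ∑' n : ℕ, c (n + 1) * z ^ n with hcs
  have hcb : ∀ n, ‖c (n + 1)‖ ≤ N / 2 * (1 / 2) ^ n := fun n => (hc n).trans_eq (by ring)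
  have hγ : ∀ z : ℂ, ‖z‖ < 3 / 2 → HasDerivAt γ (cs z) z := by
    intro z hz
    refine (hasDerivAt_tsum_mul_pow hgb hz).congr_deriv ?_
    refine tsum_congr fun n => ?_
    have h1 : ((n : ℂ) + 1) ≠ 0 := by exact_mod_cast Nat.succ_ne_zero n
    rw [hg]
    push_cast
    rw [mul_div_cancel₀ _ h1]
  have hφ : ∀ z : ℂ, ‖z‖ < 3 / 2 → HasDerivAt φ (cs z * φ z) z := by
    intro z hz
    refine (hasDerivAt_tsum_mul_pow he hz).congr_deriv ?_
    symm
    rw [hcs, tsum_mul_tsum_eq_tsum_sum_antidiagonal_of_summable_norm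
      (summable_norm_mul_pow hcb hz) (summable_norm_mul_pow he hz)]
    refine tsum_congr fun n => ?_
    rw [h.2, Finset.sum_mul]
    refine Finset.sum_congr rfl fun p hp => ?_
    rw [← Finset.HasAntidiagonal.mem_antidiagonal.1 hp, pow_add]
    ring
  have hψ : ∀ z ∈ Metric.ball (0 : ℂ) (3 / 2),
      HasDerivAt (fun z => φ z * Complex.exp (-γ z)) 0 z := by
    intro z hz
    have hz' : ‖z‖ < 3 / 2 := by simpa using hz
    refine ((hφ z hz').mul (hγ z hz').neg.cexp).congr_deriv ?_
    ring
  have hconst := (convex_ball (0 : ℂ) (3 / 2)).is_const_of_fderivWithin_eq_zero (𝕜 := ℂ)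
    (f := fun z => φ z * Complex.exp (-γ z))
    (fun z hz => (hψ z hz).differentiableAt.differentiableWithinAt)
    (fun z hz => by
      rw [fderivWithin_of_isOpen Metric.isOpen_ball hz]
      ext
      simpa using (hψ z hz).deriv)
    (show (1 : ℂ) ∈ Metric.ball (0 : ℂ) (3 / 2) by norm_num)
    (show (0 : ℂ) ∈ Metric.ball (0 : ℂ) (3 / 2) by norm_num)
  have hφ0 : φ 0 = 1 := by
    simp only [φ]
    rw [tsum_eq_single 0 (fun n hn => by simp [hn])]
    simp [h.1]
  have hγ0 : γ 0 = 0 := by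
    simp only [γ]
    rw [tsum_eq_single 0 (fun n hn => by simp [hn])]
    simp [hg]
  have hγ1 : γ 1 = ∑' k : ℕ, c (k + 1) / (k + 1) := by
    simp only [γ]
    rw [(summable_norm_mul_pow hgb (z := 1) (by norm_num)).of_norm.tsum_eq_zero_add]
    simp [hg]
  have hφ1 : φ 1 = Complex.exp (γ 1) := by
    simp only [hφ0, hγ0, neg_zero, Complex.exp_zero, mul_one] at hconst
    rw [Complex.exp_neg] at hconst
    exact (mul_inv_eq_one₀ (Complex.exp_ne_zero _)).1 hconst
  have hsum := (summable_norm_mul_pow he (z := 1) (by norm_num)).of_norm.hasSum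
  rw [show ∑' n, e n * 1 ^ n = φ 1 from rfl, hφ1, hγ1] at hsum
  simpa using hsum

/-! ### The zeta tail and its value 2^s at z = 1 -/

/-- `ζ(2k) - 1` for `k ≥ 1`. -/
noncomputable def zetaTail (k : ℕ) : ℝ :=
  (riemannZeta (2 * (k : ℂ))).re - 1

theorem zetaWeight_eq (k : ℕ) : zetaWeight k = (1 + zetaTail k) / 2 := by
  rw [zetaWeight, zetaTail]
  ring

theorem hasSum_zetaTail {k : ℕ} (hk : 1 ≤ k) :
    HasSum (fun m : ℕ => 1 / ((m : ℝ) + 2) ^ (2 * k)) (zetaTail k) := by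
  have hs : Summable fun n : ℕ => 1 / (n : ℝ) ^ (2 * k) :=
    Real.summable_one_div_nat_pow.2 (by omega)
  have hz : (riemannZeta (2 * (k : ℂ))).re = ∑' n : ℕ, 1 / (n : ℝ) ^ (2 * k) := by
    have := zeta_nat_eq_tsum_of_gt_one (k := 2 * k) (by omega)
    push_cast at this
    rw [this, ← Complex.ofReal_re (∑' n : ℕ, 1 / (n : ℝ) ^ (2 * k)), Complex.ofReal_tsum]
    push_cast
    rfl
  have h2 := (hasSum_nat_add_iff' 2).2 hs.hasSum
  rw [← hz] at h2
  simpa [Finset.sum_range_succ, show k ≠ 0 by omega, zetaTail] using h2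

theorem zetaTail_nonneg {k : ℕ} (hk : 1 ≤ k) : 0 ≤ zetaTail k :=
  (hasSum_zetaTail hk).nonneg fun m => by positivity

theorem zetaTail_le (k : ℕ) : zetaTail (k + 1) ≤ (1 / 4) ^ k := by
  have h1 : zetaTail 1 ≤ 1 := by
    rw [zetaTail, Nat.cast_one, mul_one, riemannZeta_two]
    have h : ((Real.pi : ℂ) ^ 2 / 6).re = Real.pi ^ 2 / 6 := by
      rw [show ((Real.pi : ℂ) ^ 2 / 6) = ((Real.pi ^ 2 / 6 : ℝ) : ℂ) by push_cast; rfl,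
        Complex.ofReal_re]
    rw [h]
    nlinarith [Real.pi_lt_d2, Real.pi_pos]
  have h2 : zetaTail (k + 1) ≤ (1 / 4) ^ k * zetaTail 1 := by
    refine hasSum_le (fun m => ?_) (hasSum_zetaTail (by omega))
      ((hasSum_zetaTail (k := 1) le_rfl).mul_left _)
    rw [show 2 * (k + 1) = 2 * k + 2 * 1 by ring, pow_add, pow_mul, one_div, mul_inv, one_div,
      one_div, inv_pow]
    gcongr
    nlinarith [Nat.cast_nonneg (α := ℝ) m]
  exact h2.trans (mul_le_of_le_one_right (by positivity) h1)

theorem hasSum_neg_log_one_sub_inv_sq :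
    HasSum (fun m : ℕ => -Real.log (1 - 1 / ((m : ℝ) + 2) ^ 2)) (Real.log 2) := by
  rw [hasSum_iff_tendsto_nat_of_nonneg]
  · have h : ∀ n : ℕ, ∑ m ∈ Finset.range n, -Real.log (1 - 1 / ((m : ℝ) + 2) ^ 2) =
        Real.log 2 - Real.log (1 + 1 / ((n : ℝ) + 1)) := by
      intro n
      induction n with
      | zero => norm_num
      | succ n ih =>
        rw [Finset.sum_range_succ, ih]
        have e1 : (1 : ℝ) - 1 / ((n : ℝ) + 2) ^ 2 =
            (1 + 1 / (((n + 1 : ℕ) : ℝ) + 1)) / (1 + 1 / ((n : ℝ) + 1)) := by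
          push_cast
          field_simp
          ring
        rw [e1, Real.log_div (by positivity) (by positivity)]
        ring
    simp_rw [h]
    have h1 : Tendsto (fun n : ℕ => 1 + 1 / ((n : ℝ) + 1)) atTop (nhds (1 + 0)) :=
      tendsto_one_div_add_atTop_nhds_zero_nat.const_add 1
    rw [add_zero] at h1
    have h2 := (h1.log one_ne_zero).const_sub (Real.log 2)
    simpa using h2
  · intro m
    rw [neg_nonneg]
    refine Real.log_nonpos ?_ ?_
    · rw [sub_nonneg, div_le_one (by positivity)]
      nlinarith [Nat.cast_nonneg (α := ℝ) m]
    · have : (0 : ℝ) ≤ 1 / ((m : ℝ) + 2) ^ 2 := by positivity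
      linarith

/-- Exchanging the sums over k and m ≥ 2 turns the inner sum into the Taylor series of -log(1 -
1/m²). -/
theorem tsum_zetaTail_div : ∑' k : ℕ, zetaTail (k + 1) / (k + 1) = Real.log 2 := by
  have hrow : ∀ m : ℕ, HasSum (fun k : ℕ => (1 / ((m : ℝ) + 2) ^ 2) ^ (k + 1) / (k + 1))
      (-Real.log (1 - 1 / ((m : ℝ) + 2) ^ 2)) := by
    intro m
    refine Real.hasSum_pow_div_log_of_abs_lt_one ?_
    rw [abs_of_nonneg (by positivity), div_lt_one (by positivity)]
    nlinarith [Nat.cast_nonneg (α := ℝ) m]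
  have hcol : ∀ k : ℕ, HasSum (fun m : ℕ => (1 / ((m : ℝ) + 2) ^ 2) ^ (k + 1) / (k + 1))
      (zetaTail (k + 1) / (k + 1)) := by
    intro k
    have h := (hasSum_zetaTail (k := k + 1) (by omega)).div_const ((k : ℝ) + 1)
    simpa only [pow_mul, div_pow, one_pow] using h
  have hs : Summable (Function.uncurry
      fun m k : ℕ => (1 / ((m : ℝ) + 2) ^ 2) ^ (k + 1) / ((k : ℝ) + 1)) := by
    rw [summable_prod_of_nonneg (fun p => by
      simp only [Function.uncurry, Pi.zero_apply]; positivity)]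
    refine ⟨fun m => (hrow m).summable, ?_⟩
    simp only [Function.uncurry, fun m => (hrow m).tsum_eq]
    exact hasSum_neg_log_one_sub_inv_sq.summable
  have h := hs.tsum_comm
  simp only [fun m => (hrow m).tsum_eq, fun k => (hcol k).tsum_eq,
    hasSum_neg_log_one_sub_inv_sq.tsum_eq] at h
  exact h

/-- The coefficient of `z ^ n` in `∏_{m ≥ 2} (1 - z / m ^ 2) ^ (-s)`. -/
noncomputable def tailCoeff (s : ℂ) : ℕ → ℂ :=
  cycleSum fun k => s * (zetaTail k : ℂ)

theorem norm_tail_le {N : ℕ} {s : ℂ} (hs : 4 * ‖s‖ ≤ N) (k : ℕ) :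
    ‖s * (zetaTail (k + 1) : ℂ)‖ ≤ N * (1 / 4) ^ (k + 1) := by
  rw [norm_mul, Complex.norm_real, Real.norm_of_nonneg (zetaTail_nonneg (by omega))]
  calc _ ≤ ((N : ℝ) / 4) * (1 / 4) ^ k :=
        mul_le_mul (by linarith) (zetaTail_le k) (zetaTail_nonneg (by omega)) (by positivity)
    _ = _ := by ring

theorem exists_norm_tailCoeff_le (A : ℝ) : ∃ M : ℝ, 0 ≤ M ∧ ∀ s : ℂ, ‖s‖ ≤ A → ∀ n : ℕ,
    ‖tailCoeff s n‖ ≤ M * (1 / 2) ^ n := by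
  obtain ⟨N, hN⟩ := exists_nat_ge (4 * A)
  exact ⟨(N + 1 : ℝ) ^ N, by positivity, fun s hs n =>
    (isExpSeq_cycleSum _).norm_le (norm_tail_le (by linarith)) n⟩

theorem hasSum_tailCoeff (s : ℂ) : HasSum (tailCoeff s) ((2 : ℂ) ^ s) := by
  obtain ⟨N, hN⟩ := exists_nat_ge (4 * ‖s‖)
  have h := (isExpSeq_cycleSum fun k => s * (zetaTail k : ℂ)).hasSum (N := N)
    ((isExpSeq_cycleSum _).norm_le (norm_tail_le hN))
    (fun k => (norm_tail_le hN k).trans (by gcongr; norm_num))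
  have h2 : ∑' k : ℕ, s * (zetaTail (k + 1) : ℂ) / ((k : ℂ) + 1) = Complex.log 2 * s := by
    rw [show Complex.log 2 = ((Real.log 2 : ℝ) : ℂ) by rw [Complex.ofReal_log (by norm_num)]; simp,
      ← tsum_zetaTail_div, Complex.ofReal_tsum, mul_comm, ← tsum_mul_left]
    refine tsum_congr fun k => ?_
    push_cast
    ring
  rw [h2, ← Complex.cpow_def_of_ne_zero (by norm_num)] at h
  exact h

/-- Splitting ζ(2k) = 1 + (ζ(2k) - 1) isolates the singular factor (1 - z)^(-s). -/
theorem cycleSum_one_add_zetaTail (s : ℂ) (n : ℕ) :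
    cycleSum (fun k => s * ((1 + zetaTail k : ℝ) : ℂ)) n =
      ∑ i ∈ Finset.range (n + 1), tailCoeff s i * risingCoeff s (n - i) := by
  have h := (isExpSeq_cycleSum fun k => s * (zetaTail k : ℂ)).mul (isExpSeq_risingCoeff s)
  have hc : (fun k => s * ((1 + zetaTail k : ℝ) : ℂ)) = fun k => s * (zetaTail k : ℂ) + s := by
    funext k
    push_cast
    ring
  rw [hc, (isExpSeq_cycleSum _).eq h]
  exact Finset.Nat.sum_antidiagonal_eq_sum_range_succ
    (fun i j => tailCoeff s i * risingCoeff s j) n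

/-! ### Asymptotics of the convolution -/

/-- The difference is a sum of i coefficients of (1 - z)^(1-s), each smaller by one order. The
polynomial loss in i is harmless against the geometric decay of `tailCoeff`. -/
theorem exists_scaled_sub_bound (A : ℝ) : ∃ (C : ℝ) (P : ℕ), 0 ≤ C ∧ ∀ s : ℂ, ‖s‖ ≤ A →
    ∀ n i : ℕ, 1 ≤ n → i ≤ n →
      ‖(n : ℂ) ^ (1 - s) * (risingCoeff s n - risingCoeff s (n - i))‖ ≤
        C * ((i : ℝ) + 1) ^ P / n := by
  obtain ⟨C, hC, h⟩ := exists_risingCoeff_bound (A + 1)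
  -- P dominates 2 - Re s; the extra power in P + 1 pays for the i summands.
  obtain ⟨P, hP⟩ := exists_nat_ge (A + 2)
  refine ⟨C, P + 1, hC, fun s hs n i hn hi => ?_⟩
  obtain ⟨j, rfl⟩ : ∃ j, n = j + i := ⟨n - i, by omega⟩
  have hn0 : (0 : ℝ) < ((j + i : ℕ) : ℝ) := by exact_mod_cast hn
  have hs1 : ‖s - 1‖ ≤ A + 1 := (norm_sub_le _ _).trans (by rw [norm_one]; linarith)
  have htel : risingCoeff s (j + i) - risingCoeff s (j + i - i) =
      ∑ l ∈ Finset.range i, risingCoeff (s - 1) (j + l + 1) := by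
    rw [Nat.add_sub_cancel]
    have := Finset.sum_range_sub (fun l => risingCoeff s (j + l)) i
    rw [add_zero] at this
    rw [← this]
    exact Finset.sum_congr rfl fun l _ => risingCoeff_succ_sub s (j + l)
  rw [htel, Finset.mul_sum]
  have hterm : ∀ l ∈ Finset.range i,
      ‖((j + i : ℕ) : ℂ) ^ (1 - s) * risingCoeff (s - 1) (j + l + 1)‖ ≤
        C * ((i : ℝ) + 1) ^ P / ((j + i : ℕ) : ℝ) := by
    intro l hl
    rw [Finset.mem_range] at hl
    set n : ℕ := j + i with hnd
    set m : ℕ := j + l + 1 with hm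
    have hm0 : (0 : ℝ) < (m : ℝ) := by exact_mod_cast (show 0 < m by omega)
    have hmn : (m : ℝ) ≤ n := by exact_mod_cast (show m ≤ n by omega)
    -- n = j + i ≤ m + i ≤ m (i + 1), since m ≥ j + 1 ≥ 1.
    have hnm : (n : ℝ) ≤ m * (i + 1) := by
      have : n ≤ m * (i + 1) := by
        rw [mul_add, mul_one]
        have : i ≤ m * i := Nat.le_mul_of_pos_left i (by omega)
        omega
      exact_mod_cast this
    rw [norm_mul, Complex.norm_natCast_cpow_of_pos (by omega)]
    have h1 : (n : ℝ) ^ (1 - s).re * (m : ℝ) ^ ((s - 1).re - 1) =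
        ((n : ℝ) / m) ^ (2 - s.re) / n := by
      rw [Real.div_rpow hn0.le hm0.le, Complex.sub_re, Complex.sub_re, Complex.one_re,
        show 1 - s.re = (2 - s.re) - 1 by ring, Real.rpow_sub_one hn0.ne',
        show s.re - 1 - 1 = -(2 - s.re) by ring, Real.rpow_neg hm0.le]
      ring
    have h2 : ((n : ℝ) / m) ^ (2 - s.re) ≤ ((i : ℝ) + 1) ^ P := by
      have hq : 1 ≤ (n : ℝ) / m := by rwa [one_le_div hm0]
      calc ((n : ℝ) / m) ^ (2 - s.re) ≤ ((n : ℝ) / m) ^ (P : ℝ) := by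
            refine Real.rpow_le_rpow_of_exponent_le hq ?_
            have := (abs_le.1 ((Complex.abs_re_le_norm s).trans hs)).1
            linarith
        _ = ((n : ℝ) / m) ^ P := Real.rpow_natCast _ _
        _ ≤ _ := by
            gcongr
            rw [div_le_iff₀ hm0]
            linarith
    calc _ ≤ (n : ℝ) ^ (1 - s).re * (C * (m : ℝ) ^ ((s - 1).re - 1)) := by
          gcongr
          exact h (s - 1) hs1 m (by omega)
      _ = C * (((n : ℝ) / m) ^ (2 - s.re) / n) := by rw [← h1]; ring
      _ ≤ C * (((i : ℝ) + 1) ^ P / n) := by gcongr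
      _ = _ := by ring
  refine (norm_sum_le_of_le _ hterm).trans ?_
  rw [Finset.sum_const, Finset.card_range, nsmul_eq_mul, ← mul_div_assoc]
  refine div_le_div_of_nonneg_right ?_ hn0.le
  rw [pow_succ]
  have : 0 ≤ C * ((i : ℝ) + 1) ^ P := by positivity
  nlinarith

theorem exists_scaled_cycleSum_bound (A : ℝ) : ∃ C : ℝ, 0 ≤ C ∧ ∀ s : ℂ, ‖s‖ ≤ A →
    ‖(Complex.Gamma s)⁻¹‖ ≤ C ∧ ∀ n : ℕ, 1 ≤ n →
      ‖(n : ℂ) ^ (1 - s) * cycleSum (fun k => s * ((1 + zetaTail k : ℝ) : ℂ)) n -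
        2 ^ s * (Complex.Gamma s)⁻¹‖ ≤ C / n := by
  obtain ⟨M, hM, hf⟩ := exists_norm_tailCoeff_le A
  obtain ⟨B, hB, hb⟩ := exists_scaledCoeff_bound A
  obtain ⟨D, P, hD, hd⟩ := exists_scaled_sub_bound A
  have hS : Summable fun i : ℕ => ((i : ℝ) + 1) ^ P * (1 / 2) ^ i := by
    have h := (summable_nat_add_iff 1).2
      (summable_pow_mul_geometric_of_norm_lt_one (R := ℝ) P (r := 1 / 2) (by norm_num))
    refine (h.mul_left 2).congr fun i => ?_
    push_cast
    ring
  set S : ℝ := ∑' i : ℕ, ((i : ℝ) + 1) ^ P * (1 / 2) ^ i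
  have hS0 : 0 ≤ S := tsum_nonneg fun i => by positivity
  refine ⟨M * D * S + B * (2 * M) + B * M + B, by positivity, fun s hs => ?_⟩
  refine ⟨(hb s hs).1.trans (le_add_of_nonneg_left (by positivity)), fun n hn => ?_⟩
  have hn0 : (0 : ℝ) < n := by exact_mod_cast hn
  set F : ℂ := ∑ i ∈ Finset.range (n + 1), tailCoeff s i with hF
  have hgeom : ∀ m : ℕ, HasSum (fun i : ℕ => M * (1 / 2 : ℝ) ^ (i + m)) (2 * M * (1 / 2) ^ m) := by
    intro m
    have h := hasSum_geometric_two.mul_left (M * (1 / 2 : ℝ) ^ m)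
    have e1 : (fun i : ℕ => M * (1 / 2 : ℝ) ^ (i + m)) =
        fun i => M * (1 / 2 : ℝ) ^ m * (1 / 2) ^ i := by
      funext i
      ring
    rwa [e1, show 2 * M * (1 / 2 : ℝ) ^ m = M * (1 / 2) ^ m * 2 by ring]
  have h2s : ‖(2 : ℂ) ^ s‖ ≤ 2 * M := by
    have := tsum_of_norm_bounded (hgeom 0) (f := tailCoeff s) fun i => by simpa using hf s hs i
    rw [(hasSum_tailCoeff s).tsum_eq] at this
    simpa using this
  have hFs : ‖F - 2 ^ s‖ ≤ M / n := by
    have h1 := (hasSum_nat_add_iff' (n + 1)).2 (hasSum_tailCoeff s)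
    have h2 := tsum_of_norm_bounded (hgeom (n + 1)) (f := fun i => tailCoeff s (i + (n + 1)))
      fun i => hf s hs _
    rw [h1.tsum_eq] at h2
    rw [norm_sub_rev]
    refine h2.trans ?_
    have h3 : (n : ℝ) ≤ 2 ^ n := by exact_mod_cast n.lt_two_pow_self.le
    rw [pow_succ, one_div_pow, div_eq_mul_inv M]
    calc 2 * M * (1 / 2 ^ n * (1 / 2)) = M * (2 ^ n)⁻¹ := by ring
      _ ≤ M * (n : ℝ)⁻¹ := by gcongr
  obtain ⟨-, hb2⟩ := hb s hs
  obtain ⟨hbn, hbd⟩ := hb2 n hn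
  -- Three errors: shifting the index n - i to n, replacing the scaled coefficient by 1/Γ(s), and
  -- truncating the series for 2^s.
  have hdec : (n : ℂ) ^ (1 - s) * cycleSum (fun k => s * ((1 + zetaTail k : ℝ) : ℂ)) n -
      2 ^ s * (Complex.Gamma s)⁻¹ =
      -∑ i ∈ Finset.range (n + 1), tailCoeff s i *
        ((n : ℂ) ^ (1 - s) * (risingCoeff s n - risingCoeff s (n - i))) +
      ((scaledCoeff s n - (Complex.Gamma s)⁻¹) * 2 ^ s + scaledCoeff s n * (F - 2 ^ s)) := by
    have h1 : ∑ i ∈ Finset.range (n + 1), tailCoeff s i *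
        ((n : ℂ) ^ (1 - s) * (risingCoeff s n - risingCoeff s (n - i))) =
        scaledCoeff s n * F -
          (n : ℂ) ^ (1 - s) * cycleSum (fun k => s * ((1 + zetaTail k : ℝ) : ℂ)) n := by
      rw [cycleSum_one_add_zetaTail, hF, scaledCoeff, Finset.mul_sum, Finset.mul_sum,
        ← Finset.sum_sub_distrib]
      exact Finset.sum_congr rfl fun i _ => by ring
    rw [h1]
    ring
  rw [hdec]
  have hsum : ‖-∑ i ∈ Finset.range (n + 1), tailCoeff s i *
      ((n : ℂ) ^ (1 - s) * (risingCoeff s n - risingCoeff s (n - i)))‖ ≤ M * D * S / n := by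
    rw [norm_neg]
    calc _ ≤ ∑ i ∈ Finset.range (n + 1), M * D / n * (((i : ℝ) + 1) ^ P * (1 / 2) ^ i) := by
          refine norm_sum_le_of_le _ fun i hi => ?_
          rw [Finset.mem_range] at hi
          rw [norm_mul]
          calc _ ≤ M * (1 / 2) ^ i * (D * ((i : ℝ) + 1) ^ P / n) :=
                mul_le_mul (hf s hs i) (hd s hs n i hn (by omega)) (norm_nonneg _) (by positivity)
            _ = _ := by ring
      _ ≤ M * D / n * S := by
          rw [← Finset.mul_sum]
          gcongr
          exact hS.sum_le_tsum _ fun i _ => by positivity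
      _ = _ := by ring
  calc _ ≤ M * D * S / n + (B / n * (2 * M) + B * (M / n)) := by
        refine (norm_add_le _ _).trans (add_le_add hsum ((norm_add_le _ _).trans ?_))
        rw [norm_mul, norm_mul]
        gcongr
    _ ≤ M * D * S / n + (B / n * (2 * M) + B * (M / n)) + B / n :=
        le_add_of_nonneg_right (by positivity)
    _ = _ := by ring

/-! ### The limit function and the deviation from it -/

theorem limitFun_eq (t : ℂ) :
    limitFun t = (Complex.Gamma (t / 2))⁻¹ * Complex.Gamma (1 / 2) := by
  rw [limitFun]
  rcases eq_or_ne t 0 with rfl | ht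
  · simp
  · have h1 : Complex.Gamma (3 / 2) = 1 / 2 * Complex.Gamma (1 / 2) := by
      rw [← Complex.Gamma_add_one _ (by norm_num)]
      norm_num
    have h2 : t / 2 ≠ 0 := div_ne_zero ht two_ne_zero
    rw [h1, add_comm 1 (t / 2), Complex.Gamma_add_one _ h2, div_eq_mul_inv, mul_inv, inv_div]
    field_simp

theorem differentiable_limitFun : Differentiable ℂ limitFun := by
  have h : limitFun = fun t : ℂ => (Complex.Gamma (t / 2))⁻¹ * Complex.Gamma (1 / 2) :=
    funext limitFun_eq
  rw [h]
  exact (Complex.differentiable_one_div_Gamma.comp (differentiable_id.div_const 2)).mul_const _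

/-- The generating function of the number of cycles. -/
noncomputable def cycleGenFun (n : ℕ) (t : ℂ) : ℂ :=
  expectation zetaWeight (fun σ : Equiv.Perm (Fin n) => t ^ numCycles σ)

theorem differentiable_cycleGenFun (n : ℕ) : Differentiable ℂ (cycleGenFun n) := by
  unfold cycleGenFun expectation
  fun_prop

theorem cycleGenFun_zero {n : ℕ} (hn : 1 ≤ n) : cycleGenFun n 0 = 0 := by
  rw [cycleGenFun, expectation]
  refine Finset.sum_eq_zero fun σ _ => ?_
  have h : numCycles σ ≠ 0 := by
    intro h
    have h1 : σ.partition.parts = 0 := Multiset.card_eq_zero.1 h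
    have h2 := σ.partition.parts_sum
    rw [h1, Fintype.card_fin, Multiset.sum_zero] at h2
    omega
  rw [zero_pow h, mul_zero]

theorem cycleGenFun_eq_div (n : ℕ) (t : ℂ) :
    cycleGenFun n t = cycleSum (fun k => t / 2 * ((1 + zetaTail k : ℝ) : ℂ)) n /
      cycleSum (fun k => 1 / 2 * ((1 + zetaTail k : ℝ) : ℂ)) n := by
  rw [cycleGenFun, expectation_pow_numCycles]
  congr 2
  · funext k
    rw [zetaWeight_eq]
    push_cast
    ring
  · funext k
    rw [zetaWeight_eq]
    push_cast
    ring

/-- The deviation of `E(t ^ K) (2n) ^ ((1 - t) / 2)` from its limit. -/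
noncomputable def deviation (n : ℕ) (t : ℂ) : ℂ :=
  cycleGenFun n t * Complex.exp (-((Real.log (2 * n) / 2 : ℝ) * (t - 1))) - limitFun t

theorem differentiable_deviation (n : ℕ) : Differentiable ℂ (deviation n) := by
  unfold deviation
  have h1 := differentiable_cycleGenFun n
  have h2 := differentiable_limitFun
  fun_prop

theorem deviation_zero {n : ℕ} (hn : 1 ≤ n) : deviation n 0 = 0 := by
  rw [deviation, cycleGenFun_zero hn, limitFun]
  simp

theorem cycleGenFun_eq (n : ℕ) (t : ℂ) :
    cycleGenFun n t =
      Complex.exp ((Real.log (2 * n) / 2 : ℝ) * (t - 1)) * (limitFun t + deviation n t) := by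
  rw [deviation, add_sub_cancel, mul_left_comm, ← Complex.exp_add, add_neg_cancel, Complex.exp_zero,
    mul_one]

theorem two_mul_cpow_eq_exp {n : ℕ} (hn : 1 ≤ n) (t : ℂ) :
    (2 * (n : ℂ)) ^ ((t - 1) / 2) = Complex.exp ((Real.log (2 * n) / 2 : ℝ) * (t - 1)) := by
  have h : ((2 * n : ℕ) : ℂ) ≠ 0 := by exact_mod_cast (show 2 * n ≠ 0 by omega)
  have h2 : (2 * (n : ℂ)) = ((2 * n : ℕ) : ℂ) := by push_cast; rfl
  rw [h2, Complex.cpow_def_of_ne_zero h, ← Complex.natCast_log]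
  push_cast
  congr 1
  ring

theorem exists_norm_deviation_le (A : ℝ) : ∃ C : ℝ, 0 ≤ C ∧ ∀ᶠ n : ℕ in atTop, ∀ t : ℂ,
    ‖t‖ ≤ A → ‖deviation n t‖ ≤ C / n := by
  -- The radius must cover both s = t/2 and the normalization s = 1/2.
  obtain ⟨C, hC, h⟩ := exists_scaled_cycleSum_bound (max (A / 2) (1 / 2))
  set H : ℂ → ℕ → ℂ := fun s n =>
    (n : ℂ) ^ (1 - s) * cycleSum (fun k => s * ((1 + zetaTail k : ℝ) : ℂ)) n with hH
  set κ : ℂ := 2 ^ (1 / 2 : ℂ) * (Complex.Gamma (1 / 2))⁻¹ with hκ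
  have hG0 : Complex.Gamma (1 / 2) ≠ 0 := by
    rw [Complex.Gamma_one_half_eq, Complex.cpow_ne_zero_iff]
    exact Or.inl (by exact_mod_cast Real.pi_ne_zero)
  have hκ0 : κ ≠ 0 := by
    refine mul_ne_zero ?_ (inv_ne_zero hG0)
    rw [Complex.cpow_ne_zero_iff]
    exact Or.inl two_ne_zero
  have hκn : 0 < ‖κ‖ := norm_pos_iff.2 hκ0
  obtain ⟨-, hhalf⟩ := h (1 / 2) (by norm_num)
  set R : ℝ := 2 ^ (1 / 2 + A / 2) * C + C * ‖Complex.Gamma (1 / 2)‖ * C with hR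
  have hR0 : 0 ≤ R := by positivity
  refine ⟨R / (‖κ‖ / 2), by positivity, ?_⟩
  filter_upwards [eventually_ge_atTop 1, tendsto_natCast_atTop_atTop.eventually_ge_atTop
    (C / (‖κ‖ / 2))] with n hn hnC t ht
  have hn0 : (0 : ℝ) < n := by exact_mod_cast hn
  have hnc : (n : ℂ) ≠ 0 := by exact_mod_cast hn0.ne'
  have hst : ‖t / 2‖ ≤ A / 2 := by
    rw [norm_div, Complex.norm_ofNat]
    gcongr
  obtain ⟨hD, hs⟩ := h (t / 2) (hst.trans (le_max_left _ _))
  have e1 : ‖H (t / 2) n - 2 ^ (t / 2) * (Complex.Gamma (t / 2))⁻¹‖ ≤ C / n := hs n hn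
  have e2 : ‖H (1 / 2) n - κ‖ ≤ C / n := hhalf n hn
  -- For large n the denominator is within ‖κ‖/2 of its nonzero limit κ.
  have hHn : ‖κ‖ / 2 ≤ ‖H (1 / 2) n‖ := by
    have h1 : C / n ≤ ‖κ‖ / 2 := by
      rw [div_le_iff₀ hn0, ← div_le_iff₀' (by positivity)]
      exact hnC
    have h2 := norm_sub_norm_le κ (H (1 / 2) n)
    rw [norm_sub_rev] at h2
    linarith
  have hH0 : H (1 / 2) n ≠ 0 := norm_pos_iff.1 (lt_of_lt_of_le (by positivity) hHn)
  have hpow : Complex.exp (-((Real.log (2 * n) / 2 : ℝ) * (t - 1))) =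
      2 ^ (1 / 2 - t / 2) * (n : ℂ) ^ (1 / 2 - t / 2) := by
    rw [Complex.cpow_def_of_ne_zero two_ne_zero, Complex.cpow_def_of_ne_zero hnc, ← Complex.exp_add,
      Real.log_mul two_ne_zero hn0.ne', ← Complex.natCast_log,
      show Complex.log 2 = ((Real.log 2 : ℝ) : ℂ) by rw [Complex.ofReal_log (by norm_num)]; simp]
    congr 1
    push_cast
    ring
  have hratio : cycleGenFun n t * (n : ℂ) ^ (1 / 2 - t / 2) = H (t / 2) n / H (1 / 2) n := by
    have h1 : (n : ℂ) ^ (1 - t / 2) = (n : ℂ) ^ (1 / 2 - t / 2) * (n : ℂ) ^ (1 - 1 / 2 : ℂ) := by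
      rw [← Complex.cpow_add _ _ hnc]
      congr 1
      ring
    have h2 : (n : ℂ) ^ (1 - 1 / 2 : ℂ) ≠ 0 := by
      rw [Complex.cpow_ne_zero_iff]
      exact Or.inl hnc
    rw [cycleGenFun_eq_div, hH]
    simp only
    rw [h1, mul_comm ((n : ℂ) ^ (1 / 2 - t / 2)), mul_assoc, mul_div_mul_left _ _ h2]
    ring
  have h22 : (2 : ℂ) ^ (1 / 2 - t / 2) * 2 ^ (t / 2) = 2 ^ (1 / 2 : ℂ) := by
    rw [← Complex.cpow_add _ _ two_ne_zero, sub_add_cancel]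
  clear_value H
  have hdev : deviation n t =
      (2 ^ (1 / 2 - t / 2) * (H (t / 2) n - 2 ^ (t / 2) * (Complex.Gamma (t / 2))⁻¹) -
        (Complex.Gamma (t / 2))⁻¹ * Complex.Gamma (1 / 2) * (H (1 / 2) n - κ)) /
        H (1 / 2) n := by
    rw [eq_div_iff hH0, deviation, hpow, limitFun_eq, mul_left_comm, hratio, sub_mul,
      mul_assoc _ (H (t / 2) n / H (1 / 2) n), div_mul_cancel₀ _ hH0]
    have hk : Complex.Gamma (1 / 2) * κ = 2 ^ (1 / 2 : ℂ) := by
      rw [hκ, mul_left_comm, mul_inv_cancel₀ hG0, mul_one]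
    linear_combination (Complex.Gamma (t / 2))⁻¹ * h22 - (Complex.Gamma (t / 2))⁻¹ * hk
  rw [hdev, norm_div]
  have h2n : ‖(2 : ℂ) ^ (1 / 2 - t / 2)‖ ≤ 2 ^ (1 / 2 + A / 2) := by
    have h1 := Complex.norm_natCast_cpow_of_pos (n := 2) (by norm_num) (1 / 2 - t / 2)
    rw [Nat.cast_ofNat, Nat.cast_ofNat] at h1
    rw [h1]
    refine Real.rpow_le_rpow_of_exponent_le (by norm_num) ?_
    have h2 := (abs_le.1 ((Complex.abs_re_le_norm (t / 2)).trans hst)).1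
    have h3 : (1 / 2 - t / 2).re = 1 / 2 - (t / 2).re := by
      rw [Complex.sub_re]
      norm_num
    rw [h3]
    linarith
  calc _ ≤ (2 ^ (1 / 2 + A / 2) * (C / n) + C * ‖Complex.Gamma (1 / 2)‖ * (C / n)) /
        (‖κ‖ / 2) := by
        refine div_le_div₀ (by positivity) ((norm_sub_le _ _).trans ?_) (by positivity) hHn
        rw [norm_mul, norm_mul, norm_mul]
        gcongr
    _ = _ := by
        rw [hR]
        ring

/-- The Schwarz lemma on the unit disc, using `deviation_zero`; for ‖t‖ ≥ 1 the factor ‖t‖ costs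
nothing. -/
theorem exists_norm_deviation_le_mul (A : ℝ) : ∃ C : ℝ, 0 ≤ C ∧ ∀ᶠ n : ℕ in atTop, ∀ t : ℂ,
    ‖t‖ ≤ A → ‖deviation n t‖ ≤ C / n * ‖t‖ := by
  obtain ⟨C, hC, h⟩ := exists_norm_deviation_le (max A 1)
  refine ⟨C, hC, ?_⟩
  filter_upwards [h, eventually_ge_atTop 1] with n hd hn t ht
  rcases lt_or_ge ‖t‖ 1 with h1 | h1
  · have hmaps : Set.MapsTo (deviation n) (Metric.ball 0 1)
        (Metric.closedBall (deviation n 0) (C / n)) := by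
      intro z hz
      rw [deviation_zero hn, mem_closedBall_zero_iff]
      exact hd z ((mem_ball_zero_iff.1 hz).le.trans (le_max_right _ _))
    have := Complex.dist_le_div_mul_dist_of_mapsTo_ball
      (differentiable_deviation n).differentiableOn hmaps (mem_ball_zero_iff.2 h1)
    rwa [deviation_zero hn, dist_zero_right, dist_zero_right, div_one] at this
  · exact (hd t (ht.trans (le_max_left _ _))).trans (le_mul_of_one_le_right (by positivity) h1)

/-! ### The law of the number of cycles -/

theorem iteratedDeriv_cycleGenFun (n k : ℕ) :
    iteratedDeriv k (cycleGenFun n) 0 / (k.factorial : ℂ) = (cycleLaw zetaWeight n k : ℂ) := by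
  have hk : (k.factorial : ℂ) ≠ 0 := by exact_mod_cast k.factorial_ne_zero
  unfold cycleGenFun expectation
  rw [iteratedDeriv_fun_sum (fun σ _ => by fun_prop), Finset.sum_div, cycleLaw, Finset.sum_filter]
  push_cast
  refine Finset.sum_congr rfl fun σ _ => ?_
  rw [iteratedDeriv_const_mul_field, iteratedDeriv_fun_pow_zero]
  split_ifs with h1 h2 h2
  · rw [h2, mul_div_cancel_right₀ _ hk]
  · exact absurd h1.symm h2
  · exact absurd h2.symm h1
  · simp

/-- The difference is a Taylor coefficient of exp(l(t - 1)) · `deviation`. On the unit circle Re t ≤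
1 and l ≥ 0, so the exponential has norm at most 1 and Cauchy's estimate loses nothing, uniformly in
k. -/
theorem norm_cycleLaw_sub_poissonGamma_le {n : ℕ} (hn : 1 ≤ n) {C : ℝ}
    (h : ∀ t : ℂ, ‖t‖ ≤ 1 → ‖deviation n t‖ ≤ C) (k : ℕ) :
    ‖(cycleLaw zetaWeight n k : ℂ) - poissonGamma (Real.log (2 * (n : ℝ)) / 2) k‖ ≤ C := by
  set l : ℝ := Real.log (2 * (n : ℝ)) / 2 with hl
  have hl0 : 0 ≤ l := by
    have : (1 : ℝ) ≤ n := by exact_mod_cast hn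
    exact div_nonneg (Real.log_nonneg (by linarith)) zero_le_two
  have hk : (0 : ℝ) < k.factorial := by exact_mod_cast k.factorial_pos
  have hdiff : Differentiable ℂ fun t : ℂ => Complex.exp ((l : ℂ) * (t - 1)) * deviation n t := by
    have := differentiable_deviation n
    fun_prop
  have hlim : Differentiable ℂ fun t : ℂ => Complex.exp ((l : ℂ) * (t - 1)) * limitFun t := by
    have := differentiable_limitFun
    fun_prop
  have hsub : (cycleLaw zetaWeight n k : ℂ) - poissonGamma l k =
      iteratedDeriv k (fun t : ℂ => Complex.exp ((l : ℂ) * (t - 1)) * deviation n t) 0 /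
        (k.factorial : ℂ) := by
    rw [← iteratedDeriv_cycleGenFun, poissonGamma, ← sub_div, ← iteratedDeriv_fun_sub
      (differentiable_cycleGenFun n).contDiff.contDiffAt hlim.contDiff.contDiffAt]
    congr 2
    funext t
    rw [cycleGenFun_eq]
    ring
  have hC := Complex.norm_iteratedDeriv_le_of_forall_mem_sphere_norm_le (c := 0) k one_pos
    hdiff.diffContOnCl (C := C) fun z hz => by
      have hz1 : ‖z‖ = 1 := mem_sphere_zero_iff_norm.1 hz
      rw [norm_mul, Complex.norm_exp, Complex.re_ofReal_mul, Complex.sub_re, Complex.one_re]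
      refine (mul_le_of_le_one_left (norm_nonneg _) ?_).trans (h z hz1.le)
      rw [Real.exp_le_one_iff]
      exact mul_nonpos_of_nonneg_of_nonpos hl0 (by linarith [Complex.re_le_norm z])
  rw [hsub, norm_div, Complex.norm_natCast, div_le_iff₀ hk]
  simpa [mul_comm] using hC

end CycleWeights

/-! ### The three asymptotic statements -/

theorem theorem1p9 :
    -- uniform asymptotics on every compact subset of the plane
    (∀ K : Set ℂ, IsCompact K →
      ∃ C : ℝ, ∀ᶠ n : ℕ in atTop, ∀ t ∈ K, ∃ ε : ℂ, ‖ε‖ ≤ C / (n : ℝ) ∧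
        CycleWeights.expectation CycleWeights.zetaWeight
            (fun σ : Equiv.Perm (Fin n) => t ^ CycleWeights.numCycles σ) =
          (2 * (n : ℂ)) ^ ((t - 1) / 2) * (CycleWeights.limitFun t + ε)) ∧
    -- with a relative error, away from the zeros `-2, -4, -6, …` of the reciprocal Gamma factor
    (∀ K : Set ℂ, IsCompact K → (∀ m : ℕ, 1 ≤ m → -(2 * (m : ℂ)) ∉ K) →
      ∃ C : ℝ, ∀ᶠ n : ℕ in atTop, ∀ t ∈ K, ∃ ε : ℂ, ‖ε‖ ≤ C / (n : ℝ) ∧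
        CycleWeights.expectation CycleWeights.zetaWeight
            (fun σ : Equiv.Perm (Fin n) => t ^ CycleWeights.numCycles σ) =
          (2 * (n : ℂ)) ^ ((t - 1) / 2) * CycleWeights.limitFun t * (1 + ε)) ∧
    -- the law of the number of cycles, uniformly in `k`
    (∃ C : ℝ, ∀ᶠ n : ℕ in atTop, ∀ k : ℕ, 1 ≤ k →
      ‖(CycleWeights.cycleLaw CycleWeights.zetaWeight n k : ℂ) -
          CycleWeights.poissonGamma (Real.log (2 * (n : ℝ)) / 2) k‖ ≤ C / (n : ℝ)) := by
  refine ⟨fun K hK => ?_, fun K hK hpole => ?_, ?_⟩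
  · obtain ⟨A, hA⟩ := hK.isBounded.exists_norm_le
    obtain ⟨C, -, h⟩ := CycleWeights.exists_norm_deviation_le A
    refine ⟨C, ?_⟩
    filter_upwards [h, eventually_ge_atTop 1] with n hd hn t ht
    refine ⟨CycleWeights.deviation n t, hd t (hA t ht), ?_⟩
    rw [CycleWeights.two_mul_cpow_eq_exp hn]
    exact CycleWeights.cycleGenFun_eq n t
  · obtain ⟨A, hA⟩ := hK.isBounded.exists_norm_le
    obtain ⟨C, hC, h⟩ := CycleWeights.exists_norm_deviation_le_mul A
    -- `limitFun` without its factor t: it vanishes only at -2, -4, …, so 1/g is bounded on K even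
    -- if 0 ∈ K.
    set g : ℂ → ℂ := fun t => Complex.Gamma (3 / 2) * (Complex.Gamma (1 + t / 2))⁻¹ with hg
    have hG32 : Complex.Gamma (3 / 2) ≠ 0 := Complex.Gamma_ne_zero_of_re_pos (by norm_num)
    have hg0 : ∀ t ∈ K, g t ≠ 0 := by
      intro t ht
      refine mul_ne_zero hG32 (inv_ne_zero (Complex.Gamma_ne_zero fun m hm => ?_))
      refine hpole (m + 1) (by omega) ?_
      rw [show -(2 * ((m + 1 : ℕ) : ℂ)) = t by push_cast; linear_combination -2 * hm]
      exact ht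
    have hgc : Continuous g := by
      refine continuous_const.mul (Complex.differentiable_one_div_Gamma.continuous.comp ?_)
      fun_prop
    obtain ⟨B, hB⟩ := hK.exists_bound_of_continuousOn (hgc.continuousOn.inv₀ hg0)
    refine ⟨C * B, ?_⟩
    filter_upwards [h, eventually_ge_atTop 1] with n hd hn t ht
    have hexp := CycleWeights.cycleGenFun_eq n t
    rw [← CycleWeights.two_mul_cpow_eq_exp hn] at hexp
    have hlim : CycleWeights.limitFun t = t * g t := by
      rw [CycleWeights.limitFun, hg, mul_div_assoc, div_eq_mul_inv (Complex.Gamma (3 / 2))]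
    have hB0 : 0 ≤ B := (norm_nonneg _).trans (hB t ht)
    -- At t = 0 both sides vanish, so the relative error can be taken to be 0.
    rcases eq_or_ne t 0 with rfl | h0
    · refine ⟨0, by rw [norm_zero]; positivity, ?_⟩
      rw [CycleWeights.deviation_zero hn] at hexp
      refine hexp.trans ?_
      ring
    · have hl0 : CycleWeights.limitFun t ≠ 0 := by
        rw [hlim]
        exact mul_ne_zero h0 (hg0 t ht)
      refine ⟨CycleWeights.deviation n t / CycleWeights.limitFun t, ?_, ?_⟩
      · rw [hlim, norm_div, norm_mul, div_mul_eq_div_div, div_eq_mul_inv _ ‖g t‖, ← norm_inv,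
          mul_div_right_comm]
        refine mul_le_mul ?_ (hB t ht) (norm_nonneg _) (by positivity)
        rw [div_le_iff₀ (norm_pos_iff.2 h0)]
        exact hd t (hA t ht)
      · refine hexp.trans ?_
        rw [mul_assoc, mul_add (CycleWeights.limitFun t), mul_one, mul_div_cancel₀ _ hl0]
  · obtain ⟨C, -, h⟩ := CycleWeights.exists_norm_deviation_le 1
    refine ⟨C, ?_⟩
    filter_upwards [h, eventually_ge_atTop 1] with n hd hn k _
    exact CycleWeights.norm_cycleLaw_sub_poissonGamma_le hn hd k
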